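/- **Setting.** Fix $K\ge 1$ arms. Let $\mathcal{Q}$ be either the set of all Bernoulli distributions (means in $[0,1]$) or the set of all Gaussian distributions on $\mathbb{R}$ with a fixed known variance $\sigma^2>0$ (means in $\mathbb{R}$), and let $\mathcal{P}\subseteq\mathcal{Q}$ be the subset of those distributions whose mean lies in a given set $\Theta$ of admissible means. For $\boldsymbol{P}=(P_1,\dots,P_K)\in\mathcal{P}^K$ let $\mathcal{I}^*(\boldsymbol{P})\subseteq[K]$ be the set of arms with the largest mean. Let $H:\mathcal{P}^K\to(0,\infty]$ be arbitrary, and let $D(\cdot\Vert\cdot)\in[0,\infty]$ be the Kullback–Leibler divergence. An algorithm $\pi_T$ with budget $T$ chooses, possibly at random, in each round $t=1,\dots,T$ an arm $I(t)\in[K]$ depending on the past arms and rewards, then observes a reward $X(t)$ drawn independently from $P_{I(t)}$, and after round $T$ recommends, possibly at random, an arm $J(T)\in[K]$ depending on the whole history. For a sequence of algorithms $\{\pi_T\}_T$ put $$R(\{\pi_T\})=\inf_{\boldsymbol{P}\in\mathcal{P}^K}H(\boldsymbol{P})\,\liminf_{T\to\infty}\frac1T\log\frac{1}{\mathbb{P}_{\boldsymbol{P}}[J(T)\notin\mathcal{I}^*(\boldsymbol{P})]}\in[0,\infty].$$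 For an integer $B\ge1$ put $$R^{\mathrm{go}}_B=\sup_{\boldsymbol{r}^B,\,J}\ \inf_{\boldsymbol{Q}^B\in\mathcal{Q}^{KB}}\ \inf_{\boldsymbol{P}\in\mathcal{P}^K:\,J(\boldsymbol{Q}^B)\notin\mathcal{I}^*(\boldsymbol{P})}\frac{H(\boldsymbol{P})}{B}\sum_{b=1}^B\sum_{i=1}^K r_{b,i}(\boldsymbol{Q}_1,\dots,\boldsymbol{Q}_b)\,D(Q_{b,i}\Vert P_i),$$ where $\boldsymbol{Q}^B=(\boldsymbol{Q}_1,\dots,\boldsymbol{Q}_B)$, $\boldsymbol{Q}_b=(Q_{b,1},\dots,Q_{b,K})$, and the supremum is over all functions $J:\mathcal{Q}^{KB}\to[K]$ and all $\boldsymbol{r}^B=(\boldsymbol{r}_1,\dots,\boldsymbol{r}_B)$ with $\boldsymbol{r}_b:\mathcal{Q}^{Kb}\to\{r\in[0,1]^K:\sum_i r_i=1\}$. Conventions: $\inf\emptyset=\infty$, $\log(1/0)=\infty$, and $0\cdot\infty=0$ in the products $r_{b,i}D(Q_{b,i}\Vert P_i)$; where $H(\boldsymbol{P})=\infty$ is multiplied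 by $0$ (either by a zero exponent in $R(\{\pi_T\})$ or by a zero sum in $R^{\mathrm{go}}_B$), the product is given a value $c\in[0,\infty]$, fixed once for both quantities but otherwise arbitrary (for instance $c=0$ or $c=\infty$). **Theorem (PoE bound for batch-oracle algorithms).** For every such class $\mathcal{P}$, every $H$, every convention $c$, every sequence of algorithms $\{\pi_T\}$ and every integer $B\ge1$, $$R(\{\pi_T\})\le R^{\mathrm{go}}_B.$$ -/

import Mathlib

open MeasureTheory ProbabilityTheory Filter
open scoped ENNReal NNReal

noncomputable section

namespace FixedBudget

/-- The two families of reward distributions: Bernoulli distributions, and Gaussian distributions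
with a known variance `v > 0`. -/
inductive RewardModel : Type
  | bernoulli : RewardModel
  | gaussian (v : ℝ≥0) (hv : 0 < v) : RewardModel

namespace RewardModel

/-- The range of the mean parameter in the full family `𝒬`: `[0, 1]` for Bernoulli distributions,
the real line for Gaussian distributions. Members of `𝒬` are identified with their means. -/
def means : RewardModel → Set ℝ
  | bernoulli => unitInterval
  | gaussian _ _ => Set.univ

/-- The member of the family with a given mean parameter, as a measure on `ℝ`. -/
def law : (M : RewardModel) → M.means → Measure ℝ
  | bernoulli, θ => bernoulliMeasure (1 : ℝ) 0 θ
  | gaussian v _, θ => gaussianReal θ v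

instance isProbabilityMeasure_law (M : RewardModel) (θ : M.means) :
    IsProbabilityMeasure (M.law θ) := by
  cases M with
  | bernoulli =>
    have h : ∀ p : unitInterval, IsProbabilityMeasure (bernoulliMeasure (1 : ℝ) 0 p) :=
      fun p => inferInstance
    exact h θ
  | gaussian v hv => exact inferInstanceAs (IsProbabilityMeasure (gaussianReal θ v))

/-- The parameter is indeed the mean of the distribution. -/
theorem integral_law (M : RewardModel) (θ : M.means) : ∫ x, x ∂(M.law θ) = θ := by
  cases M with
  | bernoulli =>
    have h : ∀ p : unitInterval, ∫ x, x ∂(bernoulliMeasure (1 : ℝ) 0 p) = p := fun p => by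
      rw [integral_bernoulliMeasure]
      simp
    exact h θ
  | gaussian v hv => exact integral_id_gaussianReal

/-- The Kullback-Leibler divergence `D(Q ‖ P)` between two members of the family. -/
def div (M : RewardModel) (Q P : M.means) : ℝ≥0∞ :=
  InformationTheory.klDiv (M.law Q) (M.law P)

end RewardModel

/-- A history of `t` rounds: the arm drawn and the reward observed in each round. -/
abbrev History (K t : ℕ) : Type := Fin t → Fin K × ℝ

/-- A (possibly randomized) algorithm for `K` arms with budget `T`: the next arm is drawn
depending on the history so far, and after `T` rounds an arm is recommended depending on the
whole history. Only the values of `sample t` with `t < T` are used. -/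
structure Algorithm (K T : ℕ) where
  sample : (t : ℕ) → Kernel (History K t) (Fin K)
  recommend : Kernel (History K T) (Fin K)
  markov_sample : ∀ t, IsMarkovKernel (sample t)
  markov_recommend : IsMarkovKernel recommend

instance {K T : ℕ} (π : Algorithm K T) (t : ℕ) : IsMarkovKernel (π.sample t) := π.markov_sample t

instance {K T : ℕ} (π : Algorithm K T) : IsMarkovKernel π.recommend := π.markov_recommend

/-- The kernel sending an arm to its reward distribution. -/
def rewardKernel {K : ℕ} (ν : Fin K → Measure ℝ) : Kernel (Fin K) ℝ := Kernel.ofFunOfCountable ν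

instance {K : ℕ} (ν : Fin K → Measure ℝ) [h : ∀ i, IsProbabilityMeasure (ν i)] :
    IsMarkovKernel (rewardKernel ν) := ⟨h⟩

theorem measurable_snoc {K t : ℕ} :
    Measurable (fun p : History K t × (Fin K × ℝ) =>
      (Fin.snoc (α := fun _ => Fin K × ℝ) p.1 p.2 : History K (t + 1))) := by
  refine measurable_pi_lambda _ fun i => ?_
  refine Fin.lastCases ?_ (fun j => ?_) i
  · simpa using measurable_snd
  · simp only [Fin.snoc_castSucc]
    exact (measurable_pi_apply j).comp measurable_fst

/-- The law of the history of the first `t` rounds when the algorithm `π` is run and each draw of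
arm `i` yields an independent reward with law `ν i`: given the history `h`, the next arm is drawn
from `π.sample t h`, and given the arm `i` the reward is drawn from `ν i`. -/
def historyLaw {K T : ℕ} (π : Algorithm K T) (ν : Fin K → Measure ℝ) :
    (t : ℕ) → Measure (History K t)
  | 0 => Measure.dirac Fin.elim0
  | t + 1 =>
    (historyLaw π ν t ⊗ₘ (π.sample t ⊗ₖ Kernel.prodMkLeft (History K t) (rewardKernel ν))).map
      (fun p => Fin.snoc (α := fun _ => Fin K × ℝ) p.1 p.2)

instance isProbabilityMeasure_historyLaw {K T : ℕ} (π : Algorithm K T) (ν : Fin K → Measure ℝ)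
    [∀ i, IsProbabilityMeasure (ν i)] (t : ℕ) : IsProbabilityMeasure (historyLaw π ν t) := by
  induction t with
  | zero => exact inferInstanceAs (IsProbabilityMeasure (Measure.dirac _))
  | succ t ih => exact Measure.isProbabilityMeasure_map measurable_snoc.aemeasurable

variable {M : RewardModel}

/-- The set `I*(P)` of best arms, i.e. the arms with the largest mean. -/
def bestArms {K : ℕ} {Θ : Set M.means} (P : Fin K → Θ) : Set (Fin K) :=
  {i | ∀ j, ((P j : M.means) : ℝ) ≤ ((P i : M.means) : ℝ)}

/-- The probability of error `ℙ[J(T) ∉ I*(P)]` under the instance `P`. -/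
def errorProb {K T : ℕ} {Θ : Set M.means} (π : Algorithm K T) (P : Fin K → Θ) : ℝ≥0∞ :=
  ∫⁻ h, π.recommend h (bestArms P)ᶜ ∂(historyLaw π (fun i => M.law (P i)) T)

/-- `liminf_{T → ∞} (1 / T) log (1 / ℙ[J(T) ∉ I*(P)])`, with value `∞` if the error probability
vanishes for all large `T`. The logarithm is nonnegative as the probability is at most one. -/
def errorExponent {K : ℕ} {Θ : Set M.means} (π : (T : ℕ) → Algorithm K T) (P : Fin K → Θ) :
    ℝ≥0∞ :=
  liminf (fun T : ℕ => (ENNReal.log (errorProb (π T) P)⁻¹).toENNReal / (T : ℝ≥0∞)) atTop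

/-- The product `h * x` in `[0, ∞]` where the indeterminate product `∞ * 0`, which arises at
instances of infinite complexity, is assigned the value `c`. -/
def scale (c h x : ℝ≥0∞) : ℝ≥0∞ := open Classical in if h = ∞ ∧ x = 0 then c else h * x

/-- The rate `R({π_T})`, normalized by the complexity measure `H`. -/
def rate {K : ℕ} {Θ : Set M.means} (c : ℝ≥0∞) (H : (Fin K → Θ) → ℝ≥0∞)
    (π : (T : ℕ) → Algorithm K T) : ℝ≥0∞ :=
  ⨅ P : Fin K → Θ, scale c (H P) (errorExponent π P)

/-- Batchwise allocation functions `r_1(Q_1), r_2(Q_1, Q_2), …, r_B(Q_1, …, Q_B)`: the batch with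
index `b : Fin B` is the `(b + 1)`-st one, and its allocation is a function of the first `b + 1`
empirical distributions, with values in the probability simplex. -/
abbrev Allocation (M : RewardModel) (K B : ℕ) : Type :=
  (b : Fin B) → (Fin (b + 1) → Fin K → M.means) → stdSimplex ℝ (Fin K)

/-- The first batches of `Q`, up to and including the one with index `b`. -/
def upTo {K B : ℕ} (Q : Fin B → Fin K → M.means) (b : Fin B) : Fin (b + 1) → Fin K → M.means :=
  fun a => Q (Fin.castLE b.isLt a)

/-- `(1 / B) ∑_{b, i} r_{b,i}(Q_1, …, Q_b) D(Q_{b,i} ‖ P_i)`, with `0 * ∞ = 0`. -/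
def batchDivergence {K B : ℕ} {Θ : Set M.means} (r : Allocation M K B)
    (Q : Fin B → Fin K → M.means) (P : Fin K → Θ) : ℝ≥0∞ :=
  (∑ b, ∑ i, ENNReal.ofReal ((r b (upTo Q b)).1 i) * M.div (Q b i) (P i)) / (B : ℝ≥0∞)

/-- The rate `R^go_B` of batch-oracle algorithms with `B` batches. -/
def oracleRate {K : ℕ} {Θ : Set M.means} (c : ℝ≥0∞) (H : (Fin K → Θ) → ℝ≥0∞) (B : ℕ) : ℝ≥0∞ :=
  ⨆ (r : Allocation M K B) (J : (Fin B → Fin K → M.means) → Fin K),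
    ⨅ (Q : Fin B → Fin K → M.means) (P : Fin K → Θ) (_ : J Q ∉ bestArms P),
      scale c (H P) (batchDivergence r Q P)

end FixedBudget

end

/-!
Fix `B`. Only the budgets `T = B * m` matter, as a limit inferior can only grow along a subsequence.
Run the algorithm with budget `B * m` in an environment whose reward distributions are `Q_1` in the
first `m` rounds, `Q_2` in the next `m` rounds, and so on. The numbers of pulls in a batch take at
most `(m + 1) ^ K` values. Selecting, batch after batch, the likeliest vector of pulls given the
ones selected before, and then the likeliest recommendation, yields functions
`n_b(Q_1, …, Q_b)` and `J(Q_1, …, Q_B)` whose joint event has probability at least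
`1 / (K (m + 1) ^ (K B))` (`exists_causal_selection`). The selection is causal because the law of
the first batches does not depend on the later environments.

On this event the numbers of pulls are deterministic, so that the event can be transported to a
stationary environment `P` at a cost computed from small moments of the likelihood ratio `L`:
integrating `L ≤ a + a ^ (-l) * L ^ (1 + l)` over the event and optimizing `a` bounds its
probability under `P` from below by `exp (-∑ n_{b,i} (D(Q_{b,i} ‖ P_i) + η))` up to a factor
polynomial in `m` (`le_lintegral_varyingLaw`, `exists_batch_strategy`). Here
`∫ (dQ/dP)^l dQ ≤ exp (l (D(Q ‖ P) + η))` for small `l > 0`, because the moment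
generating function of the log-likelihood ratio has derivative `D(Q ‖ P)` at `0`. If `J` is not a
best arm of `P`, the bounded event is an error.

The limits of `n_b / m` and `J` along an ultrafilter on `m` form an oracle whose batch divergence
dominates the error exponent at all `Q`, `P` with finite divergences (`exists_oracle`). Infinite
divergences are a separate matter, since `o(m)` pulls of an arm with infinite divergence vanish in
the limit while their effect does not. Mixing the limiting allocation with a small portion of the
uniform one makes the batch divergence infinite there and costs a factor close to `1` elsewhere.
-/

open MeasureTheory ProbabilityTheory Filter
open scoped ENNReal NNReal

noncomputable section

namespace FixedBudget

/-! ### Small moments of the likelihood ratio -/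

theorem lintegral_rnDeriv_rpow_eq_mgf {α : Type*} [MeasurableSpace α] {μ ν : Measure α}
    [IsProbabilityMeasure μ] [IsProbabilityMeasure ν] (hμν : μ ≪ ν) {l : ℝ}
    (hl : l ∈ integrableExpSet (llr μ ν) μ) :
    ∫⁻ x, μ.rnDeriv ν x ^ l ∂μ = ENNReal.ofReal (mgf (llr μ ν) μ l) := by
  rw [mgf, ofReal_integral_eq_lintegral_ofReal hl (ae_of_all _ fun _ => (Real.exp_pos _).le)]
  refine lintegral_congr_ae ?_
  filter_upwards [Measure.rnDeriv_pos hμν, hμν (Measure.rnDeriv_lt_top μ ν)] with x h0 h1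
  have h2 : 0 < (μ.rnDeriv ν x).toReal := ENNReal.toReal_pos h0.ne' h1.ne
  rw [llr, mul_comm, ← Real.rpow_def_of_pos h2, ← ENNReal.ofReal_rpow_of_pos h2,
    ENNReal.ofReal_toReal h1.ne]

/-- The derivative at `0` of `l ↦ ∫ (dμ/dν)^l dμ` is the Kullback-Leibler divergence, so small
moments of the likelihood ratio exceed `exp (l * D(μ ‖ ν))` by no more than a factor
`exp (l * η)`. -/
theorem eventually_lintegral_rnDeriv_rpow_le {α : Type*} [MeasurableSpace α] {μ ν : Measure α}
    [IsProbabilityMeasure μ] [IsProbabilityMeasure ν] (hμν : μ ≪ ν)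
    (h0 : 0 ∈ interior (integrableExpSet (llr μ ν) μ)) {η : ℝ} (hη : 0 < η) :
    ∀ᶠ l : ℝ in nhdsWithin 0 (Set.Ioi 0), ∫⁻ x, μ.rnDeriv ν x ^ l ∂μ ≤
      ENNReal.ofReal (Real.exp (l * ((InformationTheory.klDiv μ ν).toReal + η))) := by
  have hd : HasDerivAt (mgf (llr μ ν) μ) (InformationTheory.klDiv μ ν).toReal 0 := by
    rw [InformationTheory.toReal_klDiv_of_measure_eq hμν (by simp), ← deriv_mgf_zero h0]
    exact (differentiableAt_mgf h0).hasDerivAt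
  have h1 := (hasDerivAt_iff_tendsto_slope.1 hd).eventually
    (gt_mem_nhds (lt_add_of_pos_right _ hη))
  have h2 : ∀ᶠ l : ℝ in nhdsWithin 0 (Set.Ioi 0), slope (mgf (llr μ ν) μ) 0 l <
      (InformationTheory.klDiv μ ν).toReal + η :=
    h1.filter_mono (nhdsWithin_mono _ fun x hx => ne_of_gt hx)
  have h3 : ∀ᶠ l : ℝ in nhdsWithin 0 (Set.Ioi 0), l ∈ integrableExpSet (llr μ ν) μ :=
    nhdsWithin_le_nhds (mem_interior_iff_mem_nhds.1 h0)
  filter_upwards [h2, h3, self_mem_nhdsWithin] with l hl hl' hpos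
  have hpos : 0 < l := hpos
  rw [lintegral_rnDeriv_rpow_eq_mgf hμν hl']
  refine ENNReal.ofReal_le_ofReal ?_
  rw [slope_def_field, mgf_zero, sub_zero, div_lt_iff₀ hpos] at hl
  have := Real.add_one_le_exp (l * ((InformationTheory.klDiv μ ν).toReal + η))
  nlinarith

/-- The likelihood ratio of two Gaussian distributions with the same variance is the exponential
of an affine function. -/
theorem gaussianReal_eq_withDensity {v : ℝ≥0} (hv : v ≠ 0) (a b : ℝ) :
    gaussianReal a v = (gaussianReal b v).withDensity (fun x => ENNReal.ofReal
      (Real.exp (((a - b) / v) * x + (b ^ 2 - a ^ 2) / (2 * v)))) := by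
  rw [gaussianReal_of_var_ne_zero _ hv, gaussianReal_of_var_ne_zero _ hv,
    ← withDensity_mul _ (measurable_gaussianPDF _ _) (by fun_prop)]
  congr 1
  funext x
  have hv' : (v : ℝ) ≠ 0 := by exact_mod_cast hv
  rw [Pi.mul_apply, gaussianPDF, gaussianPDF, ← ENNReal.ofReal_mul (gaussianPDFReal_nonneg _ _ _),
    gaussianPDFReal, gaussianPDFReal, mul_assoc (√(2 * Real.pi * v))⁻¹, ← Real.exp_add]
  congr 3
  field_simp
  ring

theorem llr_gaussianReal {v : ℝ≥0} (hv : v ≠ 0) (a b : ℝ) :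
    llr (gaussianReal a v) (gaussianReal b v) =ᵐ[gaussianReal a v]
      fun x => ((a - b) / v) * x + (b ^ 2 - a ^ 2) / (2 * v) := by
  have h := gaussianReal_eq_withDensity hv a b
  have hac : gaussianReal a v ≪ gaussianReal b v := by
    rw [h]; exact withDensity_absolutelyContinuous _ _
  have h1 : (gaussianReal a v).rnDeriv (gaussianReal b v) =ᵐ[gaussianReal b v]
      fun x => ENNReal.ofReal (Real.exp (((a - b) / v) * x + (b ^ 2 - a ^ 2) / (2 * v))) := by
    conv_lhs => rw [h]
    exact Measure.rnDeriv_withDensity _ (by fun_prop)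
  filter_upwards [hac.ae_le h1] with x hx
  rw [llr, hx, ENNReal.toReal_ofReal (Real.exp_pos _).le, Real.log_exp]

theorem integrableExpSet_llr_gaussianReal {v : ℝ≥0} (hv : v ≠ 0) (a b : ℝ) :
    integrableExpSet (llr (gaussianReal a v) (gaussianReal b v)) (gaussianReal a v) =
      Set.univ := by
  refine Set.eq_univ_of_forall fun t => ?_
  have h : Integrable (fun x => Real.exp (t * ((a - b) / v) * x) *
      Real.exp (t * ((b ^ 2 - a ^ 2) / (2 * v)))) (gaussianReal a v) :=
    (integrable_exp_mul_gaussianReal _).mul_const _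
  refine h.congr ?_
  filter_upwards [llr_gaussianReal hv a b] with x hx
  rw [hx, ← Real.exp_add]
  ring_nf

namespace RewardModel

theorem integrableExpSet_llr_law (M : RewardModel) (Q P : M.means) :
    integrableExpSet (llr (M.law Q) (M.law P)) (M.law Q) = Set.univ := by
  cases M with
  | bernoulli => exact Set.eq_univ_of_forall fun t => integrable_bernoulliMeasure _ _ _ _
  | gaussian v hv => exact integrableExpSet_llr_gaussianReal hv.ne' _ _

theorem law_absolutelyContinuous (M : RewardModel) {Q P : M.means} (h : M.div Q P ≠ ∞) :
    M.law Q ≪ M.law P :=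
  (InformationTheory.klDiv_ne_top_iff.1 h).1

theorem eventually_lintegral_rnDeriv_law_rpow_le (M : RewardModel) {Q P : M.means}
    (h : M.div Q P ≠ ∞) {η : ℝ} (hη : 0 < η) :
    ∀ᶠ l : ℝ in nhdsWithin 0 (Set.Ioi 0), ∫⁻ x, (M.law Q).rnDeriv (M.law P) x ^ l ∂(M.law Q) ≤
      ENNReal.ofReal (Real.exp (l * ((M.div Q P).toReal + η))) :=
  eventually_lintegral_rnDeriv_rpow_le (M.law_absolutelyContinuous h)
    (by simp [integrableExpSet_llr_law]) hη

end RewardModel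

/-! ### Running an algorithm in a time-varying environment -/

variable {K T : ℕ}

/-- The law of the history of the first `t` rounds when the algorithm `π` is run and the reward of
arm `i` in round `s` has law `ν s i`. -/
def varyingLaw (π : Algorithm K T) (ν : ℕ → Fin K → Measure ℝ) :
    (t : ℕ) → Measure (History K t)
  | 0 => Measure.dirac Fin.elim0
  | t + 1 =>
    (varyingLaw π ν t ⊗ₘ
      (π.sample t ⊗ₖ Kernel.prodMkLeft (History K t) (rewardKernel (ν t)))).map
      (fun p => Fin.snoc (α := fun _ => Fin K × ℝ) p.1 p.2)

instance isProbabilityMeasure_varyingLaw (π : Algorithm K T) (ν : ℕ → Fin K → Measure ℝ)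
    [∀ s i, IsProbabilityMeasure (ν s i)] (t : ℕ) :
    IsProbabilityMeasure (varyingLaw π ν t) := by
  induction t with
  | zero => exact inferInstanceAs (IsProbabilityMeasure (Measure.dirac _))
  | succ t ih => exact Measure.isProbabilityMeasure_map measurable_snoc.aemeasurable

theorem varyingLaw_const (π : Algorithm K T) (ν : Fin K → Measure ℝ) (t : ℕ) :
    varyingLaw π (fun _ => ν) t = historyLaw π ν t := by
  induction t with
  | zero => rfl
  | succ t ih => rw [varyingLaw, historyLaw, ih]

theorem varyingLaw_congr (π : Algorithm K T) {ν ρ : ℕ → Fin K → Measure ℝ} {t : ℕ}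
    (h : ∀ s < t, ν s = ρ s) : varyingLaw π ν t = varyingLaw π ρ t := by
  induction t with
  | zero => rfl
  | succ t ih =>
    rw [varyingLaw, varyingLaw, ih fun s hs => h s (hs.trans t.lt_succ_self), h t t.lt_succ_self]

theorem lintegral_varyingLaw_succ (π : Algorithm K T) (ν : ℕ → Fin K → Measure ℝ)
    [∀ s i, IsProbabilityMeasure (ν s i)] {t : ℕ} {f : History K (t + 1) → ℝ≥0∞}
    (hf : Measurable f) :
    ∫⁻ h, f h ∂(varyingLaw π ν (t + 1)) = ∫⁻ h, ∫⁻ i, ∫⁻ x,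
      f (Fin.snoc (α := fun _ => Fin K × ℝ) h (i, x)) ∂(ν t i) ∂(π.sample t h)
        ∂(varyingLaw π ν t) := by
  have hf' : Measurable fun p : History K t × (Fin K × ℝ) =>
      f (Fin.snoc (α := fun _ => Fin K × ℝ) p.1 p.2) := hf.comp measurable_snoc
  rw [varyingLaw, lintegral_map hf measurable_snoc, Measure.lintegral_compProd hf']
  refine lintegral_congr fun h => ?_
  exact Kernel.lintegral_compProd _ _ _ (hf'.comp (measurable_const.prodMk measurable_id))

theorem measurable_prod_history {g : ℕ → Fin K → ℝ → ℝ≥0∞} (hg : ∀ s i, Measurable (g s i))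
    (t : ℕ) : Measurable fun h : History K t => ∏ s : Fin t, g s (h s).1 (h s).2 := by
  refine Finset.measurable_prod _ fun s _ => ?_
  have : Measurable fun p : Fin K × ℝ => g s p.1 p.2 := measurable_from_prod_countable_right (hg s)
  exact this.comp (measurable_pi_apply s)

theorem prod_snoc (g : ℕ → Fin K → ℝ → ℝ≥0∞) {t : ℕ} (h : History K t) (i : Fin K) (x : ℝ) :
    ∏ s : Fin (t + 1), g s (Fin.snoc (α := fun _ => Fin K × ℝ) h (i, x) s).1
        (Fin.snoc (α := fun _ => Fin K × ℝ) h (i, x) s).2 =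
      (∏ s : Fin t, g s (h s).1 (h s).2) * g t i x := by
  rw [Fin.prod_univ_castSucc]
  simp

/-- Change of measure: the likelihood ratio of the histories in two environments is the product of
the likelihood ratios of the rewards, as the probabilities of the choices of arms cancel. -/
theorem lintegral_varyingLaw_withDensity (π : Algorithm K T) {ν ρ : ℕ → Fin K → Measure ℝ}
    [∀ s i, IsProbabilityMeasure (ν s i)] [∀ s i, IsProbabilityMeasure (ρ s i)]
    {g : ℕ → Fin K → ℝ → ℝ≥0∞} (hg : ∀ s i, Measurable (g s i))
    (hν : ∀ s i, ν s i = (ρ s i).withDensity (g s i)) {t : ℕ} {f : History K t → ℝ≥0∞}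
    (hf : Measurable f) :
    ∫⁻ h, f h ∂(varyingLaw π ν t) =
      ∫⁻ h, f h * ∏ s : Fin t, g s (h s).1 (h s).2 ∂(varyingLaw π ρ t) := by
  induction t with
  | zero => simp [varyingLaw]
  | succ t ih =>
    have hg' : Measurable fun p : Fin K × ℝ => g t p.1 p.2 :=
      measurable_from_prod_countable_right (hg t)
    have hF : Measurable fun p : History K t × (Fin K × ℝ) =>
        f (Fin.snoc (α := fun _ => Fin K × ℝ) p.1 p.2) * g t p.2.1 p.2.2 :=
      (hf.comp measurable_snoc).mul (hg'.comp measurable_snd)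
    have hfg : Measurable fun h : History K (t + 1) => f h * ∏ s : Fin (t + 1), g s (h s).1 (h s).2 :=
      hf.mul (measurable_prod_history hg _)
    rw [lintegral_varyingLaw_succ π ν hf, lintegral_varyingLaw_succ π ρ hfg]
    have hFh : ∀ h : History K t, Measurable fun p : Fin K × ℝ =>
        f (Fin.snoc (α := fun _ => Fin K × ℝ) h p) * g t p.1 p.2 :=
      fun h => hF.comp (measurable_const.prodMk measurable_id)
    have h1 : ∀ h : History K t, ∫⁻ i, ∫⁻ x, f (Fin.snoc (α := fun _ => Fin K × ℝ) h (i, x))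
        ∂(ν t i) ∂(π.sample t h) = ∫⁻ p, f (Fin.snoc (α := fun _ => Fin K × ℝ) h p) *
          g t p.1 p.2
          ∂((π.sample t ⊗ₖ Kernel.prodMkLeft (History K t) (rewardKernel (ρ t))) h) := by
      intro h
      rw [Kernel.lintegral_compProd _ _ _ (hFh h)]
      refine lintegral_congr fun i => ?_
      have hfx : Measurable fun x : ℝ => f (Fin.snoc (α := fun _ => Fin K × ℝ) h (i, x)) :=
        hf.comp (measurable_snoc.comp
          (measurable_const.prodMk (measurable_const.prodMk measurable_id)))
      rw [hν t i, lintegral_withDensity_eq_lintegral_mul _ (hg t i) hfx]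
      simp_rw [Pi.mul_apply, mul_comm (g t i _)]
      rfl
    simp_rw [h1]
    rw [ih (Measurable.lintegral_kernel_prod_right' hF)]
    refine lintegral_congr fun h => ?_
    rw [← lintegral_mul_const _ (hFh h),
      Kernel.lintegral_compProd _ _ _ ((hFh h).mul_const _)]
    refine lintegral_congr fun i => lintegral_congr fun x => ?_
    simp only [prod_snoc]
    ring

/-- A product over the rounds of factors with conditional mean at most one has mean at most one. -/
theorem lintegral_prod_varyingLaw_le_one (π : Algorithm K T) {ν : ℕ → Fin K → Measure ℝ}
    [∀ s i, IsProbabilityMeasure (ν s i)] {g : ℕ → Fin K → ℝ → ℝ≥0∞}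
    (hg : ∀ s i, Measurable (g s i)) (h1 : ∀ s i, ∫⁻ x, g s i x ∂(ν s i) ≤ 1) (t : ℕ) :
    ∫⁻ h, ∏ s : Fin t, g s (h s).1 (h s).2 ∂(varyingLaw π ν t) ≤ 1 := by
  induction t with
  | zero => simp [varyingLaw]
  | succ t ih =>
    rw [lintegral_varyingLaw_succ π ν (measurable_prod_history hg _)]
    refine le_trans (lintegral_mono fun h => ?_) ih
    calc _ = ∫⁻ i, (∏ s : Fin t, g s (h s).1 (h s).2) * ∫⁻ x, g t i x ∂(ν t i)
          ∂(π.sample t h) := by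
          simp_rw [prod_snoc]
          exact lintegral_congr fun i => lintegral_const_mul _ (hg t i)
      _ ≤ ∫⁻ i, ∏ s : Fin t, g s (h s).1 (h s).2 ∂(π.sample t h) :=
          lintegral_mono fun i => mul_le_of_le_one_right' (h1 t i)
      _ = _ := by simp

/-- The first `t` rounds of a history. -/
def History.take {t u : ℕ} (htu : t ≤ u) (h : History K u) : History K t :=
  fun s => h (Fin.castLE htu s)

theorem History.measurable_take {t u : ℕ} (htu : t ≤ u) :
    Measurable (History.take (K := K) htu) :=
  measurable_pi_lambda _ fun _ => measurable_pi_apply _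

theorem map_take_varyingLaw (π : Algorithm K T) (ν : ℕ → Fin K → Measure ℝ)
    [∀ s i, IsProbabilityMeasure (ν s i)] {t u : ℕ} (htu : t ≤ u) :
    (varyingLaw π ν u).map (History.take htu) = varyingLaw π ν t := by
  induction u, htu using Nat.le_induction with
  | base => exact Measure.map_id
  | succ u htu ih =>
    rw [← ih, varyingLaw, Measure.map_map (History.measurable_take _) measurable_snoc]
    conv_rhs => rw [← Measure.fst_compProd (varyingLaw π ν u)
      (π.sample u ⊗ₖ Kernel.prodMkLeft (History K u) (rewardKernel (ν u)))]
    rw [Measure.fst, Measure.map_map (History.measurable_take _) measurable_fst]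
    congr 1
    funext p s
    exact Fin.snoc_castSucc (α := fun _ => Fin K × ℝ) p.2 p.1 (Fin.castLE htu s)

/-- Events of the first `t` rounds have the same probability in environments that agree there. -/
theorem varyingLaw_preimage_take_congr (π : Algorithm K T) {ν ρ : ℕ → Fin K → Measure ℝ}
    [∀ s i, IsProbabilityMeasure (ν s i)] [∀ s i, IsProbabilityMeasure (ρ s i)] {t u : ℕ}
    (htu : t ≤ u) (h : ∀ s < t, ν s = ρ s) {A : Set (History K t)} (hA : MeasurableSet A) :
    varyingLaw π ν u (History.take htu ⁻¹' A) = varyingLaw π ρ u (History.take htu ⁻¹' A) := by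
  rw [← Measure.map_apply (History.measurable_take htu) hA,
    ← Measure.map_apply (History.measurable_take htu) hA, map_take_varyingLaw, map_take_varyingLaw,
    varyingLaw_congr π h]

/-! ### A lower bound on probabilities under a change of environment -/

/-- Either the likelihood ratio is at most `a`, or it is at most `(L / a) ^ l * L`. -/
theorem le_add_rpow_neg_mul (L : ℝ≥0∞) {a : ℝ≥0∞} (ha : a ≠ 0) (ha' : a ≠ ∞) {l : ℝ} (hl : 0 < l) :
    L ≤ a + a ^ (-l) * (L ^ l * L) := by
  rcases le_total L a with h | h
  · exact h.trans le_self_add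
  · refine le_add_left ?_
    have h1 : 1 ≤ a ^ (-l) * L ^ l := by
      rw [ENNReal.rpow_neg, ← ENNReal.inv_mul_cancel
        (ENNReal.rpow_pos (pos_iff_ne_zero.2 ha) ha').ne' (ENNReal.rpow_ne_top_of_nonneg hl.le ha')]
      gcongr
    rw [← mul_assoc]
    exact le_mul_of_one_le_left' h1

theorem lintegral_varyingLaw_le_add (π : Algorithm K T) {ν ρ : ℕ → Fin K → Measure ℝ}
    [∀ s i, IsProbabilityMeasure (ν s i)] [∀ s i, IsProbabilityMeasure (ρ s i)]
    (hac : ∀ s i, ν s i ≪ ρ s i) {l : ℝ} (hl : 0 < l) {E : ℕ → Fin K → ℝ}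
    (hE : ∀ s i, ∫⁻ x, (ν s i).rnDeriv (ρ s i) x ^ l ∂(ν s i) ≤ ENNReal.ofReal (Real.exp (E s i)))
    {t : ℕ} {w : History K t → ℝ≥0∞} (hw : Measurable w) (hw1 : ∀ h, w h ≤ 1) {C : ℝ}
    (hC : ∀ h, w h ≠ 0 → ∑ s : Fin t, E s (h s).1 ≤ C) {a : ℝ≥0∞} (ha : a ≠ 0) (ha' : a ≠ ∞) :
    ∫⁻ h, w h ∂(varyingLaw π ν t) ≤
      a * ∫⁻ h, w h ∂(varyingLaw π ρ t) + a ^ (-l) * ENNReal.ofReal (Real.exp C) := by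
  set g : ℕ → Fin K → ℝ → ℝ≥0∞ := fun s i => (ν s i).rnDeriv (ρ s i) with hg_def
  have hg : ∀ s i, Measurable (g s i) := fun s i => Measure.measurable_rnDeriv _ _
  have hν : ∀ s i, ν s i = (ρ s i).withDensity (g s i) := fun s i =>
    (Measure.withDensity_rnDeriv_eq _ _ (hac s i)).symm
  set L : History K t → ℝ≥0∞ := fun h => ∏ s : Fin t, g s (h s).1 (h s).2 with hL_def
  have hL : Measurable L := measurable_prod_history hg t
  have hLl : Measurable fun h => w h * L h ^ l := hw.mul (hL.pow_const l)
  have hLlL : Measurable fun h => w h * L h ^ l * L h := hLl.mul hL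
  -- The factors `g ^ l * exp (-E)` have conditional mean at most one.
  set G : ℕ → Fin K → ℝ → ℝ≥0∞ := fun s i x =>
    g s i x ^ l * ENNReal.ofReal (Real.exp (-E s i)) with hG_def
  have hG : ∀ s i, Measurable (G s i) := fun s i => ((hg s i).pow_const l).mul_const _
  have hG1 : ∀ s i, ∫⁻ x, G s i x ∂(ν s i) ≤ 1 := by
    intro s i
    rw [hG_def, lintegral_mul_const _ ((hg s i).pow_const l)]
    calc _ ≤ ENNReal.ofReal (Real.exp (E s i)) * ENNReal.ofReal (Real.exp (-E s i)) := by
          gcongr; exact hE s i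
      _ = 1 := by
          rw [← ENNReal.ofReal_mul (Real.exp_pos _).le, ← Real.exp_add]
          simp
  have hmoment : ∫⁻ h, w h * L h ^ l ∂(varyingLaw π ν t) ≤ ENNReal.ofReal (Real.exp C) := by
    have hpt : ∀ h, w h * L h ^ l ≤
        ENNReal.ofReal (Real.exp C) * ∏ s : Fin t, G s (h s).1 (h s).2 := by
      intro h
      by_cases h0 : w h = 0
      · simp [h0]
      have hprod : ∏ s : Fin t, G s (h s).1 (h s).2 =
          L h ^ l * ENNReal.ofReal (Real.exp (-∑ s : Fin t, E s (h s).1)) := by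
        rw [hG_def, Finset.prod_mul_distrib, ← Finset.sum_neg_distrib, Real.exp_sum,
          ENNReal.ofReal_prod_of_nonneg fun _ _ => (Real.exp_pos _).le, hL_def,
          ENNReal.prod_rpow_of_nonneg hl.le]
      rw [hprod, mul_left_comm, ← ENNReal.ofReal_mul (Real.exp_pos _).le, ← Real.exp_add,
        mul_comm (w h)]
      gcongr
      refine (hw1 h).trans ?_
      rw [← ENNReal.ofReal_one]
      refine ENNReal.ofReal_le_ofReal (Real.one_le_exp ?_)
      linarith [hC h h0]
    calc _ ≤ ∫⁻ h, ENNReal.ofReal (Real.exp C) * ∏ s : Fin t, G s (h s).1 (h s).2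
          ∂(varyingLaw π ν t) := lintegral_mono hpt
      _ = ENNReal.ofReal (Real.exp C) * ∫⁻ h, ∏ s : Fin t, G s (h s).1 (h s).2
          ∂(varyingLaw π ν t) := lintegral_const_mul _ (measurable_prod_history hG t)
      _ ≤ _ := mul_le_of_le_one_right' (lintegral_prod_varyingLaw_le_one π hG hG1 t)
  rw [lintegral_varyingLaw_withDensity π hg hν hw]
  rw [lintegral_varyingLaw_withDensity π hg hν hLl] at hmoment
  calc _ ≤ ∫⁻ h, a * w h + a ^ (-l) * (w h * L h ^ l * L h) ∂(varyingLaw π ρ t) := by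
        refine lintegral_mono fun h => ?_
        calc w h * L h ≤ w h * (a + a ^ (-l) * (L h ^ l * L h)) := by
              gcongr; exact le_add_rpow_neg_mul _ ha ha' hl
          _ = _ := by ring
    _ = a * ∫⁻ h, w h ∂(varyingLaw π ρ t) +
          a ^ (-l) * ∫⁻ h, w h * L h ^ l * L h ∂(varyingLaw π ρ t) := by
        rw [lintegral_add_left (hw.const_mul a), lintegral_const_mul _ hw,
          lintegral_const_mul _ hLlL]
    _ ≤ _ := by gcongr

/-- If an event (or a `[0, 1]`-valued weight) has probability at least `p` in the environment `ν`,
and the conditional `l`-th moments of the likelihood ratio multiply to at most `exp C` on it, then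
its probability in the environment `ρ` is not much smaller than `exp (-C / l)`. -/
theorem le_lintegral_varyingLaw (π : Algorithm K T) {ν ρ : ℕ → Fin K → Measure ℝ}
    [∀ s i, IsProbabilityMeasure (ν s i)] [∀ s i, IsProbabilityMeasure (ρ s i)]
    (hac : ∀ s i, ν s i ≪ ρ s i) {l : ℝ} (hl : 0 < l) {E : ℕ → Fin K → ℝ}
    (hE : ∀ s i, ∫⁻ x, (ν s i).rnDeriv (ρ s i) x ^ l ∂(ν s i) ≤ ENNReal.ofReal (Real.exp (E s i)))
    {t : ℕ} {w : History K t → ℝ≥0∞} (hw : Measurable w) (hw1 : ∀ h, w h ≤ 1) {C : ℝ}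
    (hC : ∀ h, w h ≠ 0 → ∑ s : Fin t, E s (h s).1 ≤ C) {p : ℝ} (hp : 0 < p)
    (hpw : ENNReal.ofReal p ≤ ∫⁻ h, w h ∂(varyingLaw π ν t)) :
    ENNReal.ofReal (Real.exp (-((1 + 1 / l) * Real.log (2 / p) + C / l))) ≤
      ∫⁻ h, w h ∂(varyingLaw π ρ t) := by
  -- The threshold for which the second term of `lintegral_varyingLaw_le_add` equals `p / 2`.
  set A : ℝ := (Real.log (2 / p) + C) / l with hA
  have h := hpw.trans (lintegral_varyingLaw_le_add π hac hl hE hw hw1 hC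
    (a := ENNReal.ofReal (Real.exp A)) (by simp [Real.exp_pos]) ENNReal.ofReal_ne_top)
  have hx : ∫⁻ h, w h ∂(varyingLaw π ρ t) ≠ ∞ :=
    ((lintegral_mono hw1).trans_lt (by simp)).ne
  obtain ⟨x, hx0, hxe⟩ : ∃ x : ℝ, 0 ≤ x ∧ ∫⁻ h, w h ∂(varyingLaw π ρ t) = ENNReal.ofReal x :=
    ⟨_, ENNReal.toReal_nonneg, (ENNReal.ofReal_toReal hx).symm⟩
  have hexp : Real.exp A ^ (-l) * Real.exp C = p / 2 := by
    rw [← Real.exp_mul, ← Real.exp_add, ← Real.exp_log (by positivity : (0 : ℝ) < p / 2)]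
    congr 1
    rw [← inv_div, Real.log_inv, hA]
    field_simp
    ring
  rw [hxe, ENNReal.ofReal_rpow_of_pos (Real.exp_pos _), ← ENNReal.ofReal_mul (Real.exp_pos _).le,
    ← ENNReal.ofReal_mul (by positivity), hexp, ← ENNReal.ofReal_add (by positivity) (by positivity),
    ENNReal.ofReal_le_ofReal_iff (by positivity)] at h
  rw [hxe]
  refine ENNReal.ofReal_le_ofReal ?_
  have h2 : Real.exp (-((1 + 1 / l) * Real.log (2 / p) + C / l)) =
      (p / 2) * Real.exp (-A) := by
    rw [← Real.exp_log (by positivity : (0 : ℝ) < p / 2), ← Real.exp_add, ← inv_div 2 p,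
      Real.log_inv, hA]
    congr 1
    field_simp
    ring
  rw [h2]
  calc p / 2 * Real.exp (-A) ≤ (Real.exp A * x) * Real.exp (-A) := by gcongr; linarith
    _ = x := by rw [mul_right_comm, ← Real.exp_add]; simp

/-! ### Causal selection of likely statistics -/

/-- Let `c 0 ω, c 1 ω, …` be statistics with finitely many values whose first `b` terms have a law
depending only on the first `b` terms of a parameter sequence `θ`. Selecting for each `b` in turn
the likeliest value of `c b` next to the values selected already gives a causal function of `θ`,
whose values are attained with probability at least `|N| ^ (-B)`. -/
theorem exists_causal_selection {X N Ω : Type*} [Fintype N] [Nonempty N] [MeasurableSpace Ω]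
    (μ : (ℕ → X) → Measure Ω) [∀ θ, IsProbabilityMeasure (μ θ)] (c : ℕ → Ω → N) (B : ℕ)
    (hμ : ∀ b ≤ B, ∀ θ θ' : ℕ → X, (∀ a < b, θ a = θ' a) → ∀ n : ℕ → N,
      μ θ {ω | ∀ a < b, c a ω = n a} = μ θ' {ω | ∀ a < b, c a ω = n a}) :
    ∃ sel : (ℕ → X) → ℕ → N,
      (∀ b < B, ∀ θ θ' : ℕ → X, (∀ a ≤ b, θ a = θ' a) → sel θ b = sel θ' b) ∧
      ∀ θ, 1 ≤ (Fintype.card N : ℝ≥0∞) ^ B * μ θ {ω | ∀ a < B, c a ω = sel θ a} := by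
  induction B with
  | zero => exact ⟨fun _ _ => Classical.arbitrary N, by simp, by simp⟩
  | succ B ih =>
    obtain ⟨sel, hsel, hprob⟩ := ih fun b hb => hμ b (hb.trans B.le_succ)
    choose am ham using fun f : N → ℝ≥0∞ => Finite.exists_max f
    have hF : ∀ θ k, {ω | ∀ a < B + 1, c a ω = Function.update (sel θ) B k a} =
        {ω | (∀ a < B, c a ω = sel θ a) ∧ c B ω = k} := by
      intro θ k
      ext ω
      simp only [Set.mem_ofPred_eq, Nat.forall_lt_succ_right, Function.update_self]
      refine and_congr_left' (forall₂_congr fun a ha => ?_)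
      rw [Function.update_of_ne ha.ne]
    refine ⟨fun θ => Function.update (sel θ) B
      (am fun k => μ θ {ω | ∀ a < B + 1, c a ω = Function.update (sel θ) B k a}), ?_, ?_⟩
    · intro b hb θ θ' h
      dsimp only
      rcases Nat.lt_succ_iff_lt_or_eq.1 hb with hb | rfl
      · rw [Function.update_of_ne hb.ne, Function.update_of_ne hb.ne, hsel b hb θ θ' h]
      · rw [Function.update_self, Function.update_self]
        congr 1
        funext k
        rw [hμ (b + 1) le_rfl θ θ' fun a ha => h a (Nat.lt_succ_iff.1 ha)]
        congr 1
        rw [hF, hF]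
        ext ω
        refine and_congr_left' (forall₂_congr fun a ha => ?_)
        rw [hsel a ha θ θ' fun a' ha' => h a' (ha'.trans ha.le)]
    · intro θ
      refine (hprob θ).trans ?_
      rw [pow_succ, mul_assoc]
      gcongr
      set f : N → ℝ≥0∞ :=
        fun k => μ θ {ω | ∀ a < B + 1, c a ω = Function.update (sel θ) B k a} with hf
      calc μ θ {ω | ∀ a < B, c a ω = sel θ a}
          ≤ μ θ (⋃ k, {ω | ∀ a < B + 1, c a ω = Function.update (sel θ) B k a}) := by
            refine measure_mono fun ω hω => Set.mem_iUnion.2 ⟨c B ω, ?_⟩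
            rw [hF]
            exact ⟨hω, rfl⟩
        _ ≤ ∑ k, f k := measure_iUnion_fintype_le _ _
        _ ≤ ∑ _k : N, f (am f) := Finset.sum_le_sum fun k _ => ham f k
        _ = _ := by simp [hf]

/-! ### Numbers of pulls in batches -/

/-- The numbers of pulls of the arms in the batch with index `a`, which consists of the rounds
`a * m, …, a * m + m - 1`, for a sequence `f` of `t` arms. Rounds from `t` on are ignored. -/
def pulls {K t : ℕ} (m a : ℕ) (f : Fin t → Fin K) (i : Fin K) : Fin (m + 1) :=
  ⟨(Finset.univ.filter fun j : Fin m => ∃ hs : j + m * a < t, f ⟨j + m * a, hs⟩ = i).card,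
    Nat.lt_succ_iff.2 ((Finset.card_filter_le _ _).trans (by simp))⟩

theorem add_mul_lt_mul {m a b : ℕ} (j : Fin m) (hab : a < b) : j + m * a < b * m := by
  calc j + m * a < m + m * a := Nat.add_lt_add_right j.2 _
    _ = (a + 1) * m := by ring
    _ ≤ b * m := Nat.mul_le_mul_right _ hab

theorem pulls_eq_card {K B m : ℕ} {a : ℕ} (ha : a < B) (f : Fin (B * m) → Fin K) (i : Fin K) :
    (pulls m a f i : ℕ) =
      (Finset.univ.filter fun j : Fin m => f ⟨j + m * a, add_mul_lt_mul j ha⟩ = i).card := by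
  rw [pulls, Fin.val_mk]
  refine congrArg Finset.card (Finset.ext fun j => ?_)
  simp [add_mul_lt_mul j ha]

theorem sum_pulls {K B m : ℕ} {a : ℕ} (ha : a < B) (f : Fin (B * m) → Fin K) :
    ∑ i, (pulls m a f i : ℕ) = m := by
  simp_rw [pulls_eq_card ha]
  rw [← Finset.card_eq_sum_card_fiberwise (fun _ _ => Finset.mem_coe.2 (Finset.mem_univ _))]
  simp

/-- Summing over rounds a quantity that depends on the batch and the arm pulled. -/
theorem sum_rounds_eq_sum_pulls {K B m : ℕ} (E : ℕ → Fin K → ℝ) (f : Fin (B * m) → Fin K) :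
    ∑ s : Fin (B * m), E (s / m) (f s) =
      ∑ b ∈ Finset.range B, ∑ i, (pulls m b f i : ℕ) * E b i := by
  rw [← finProdFinEquiv.sum_comp, Fintype.sum_prod_type, ← Fin.sum_univ_eq_sum_range
    (fun b => ∑ i, ((pulls m b f i : ℕ) : ℝ) * E b i)]
  refine Finset.sum_congr rfl fun b _ => ?_
  have h1 : ∀ j : Fin m, E ((finProdFinEquiv (b, j) : Fin (B * m)) / m)
      (f (finProdFinEquiv (b, j))) = E b (f ⟨j + m * b, add_mul_lt_mul j b.2⟩) := by
    intro j
    have hm : 0 < m := j.pos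
    congr 1
    simp [finProdFinEquiv, Nat.add_mul_div_left _ _ hm]
  simp_rw [h1, pulls_eq_card b.2]
  rw [← Finset.sum_fiberwise (Finset.univ : Finset (Fin m))
    (fun j => f ⟨j + m * b, add_mul_lt_mul j b.2⟩)]
  refine Finset.sum_congr rfl fun i _ => ?_
  rw [Finset.sum_congr rfl fun j hj => by rw [(Finset.mem_filter.1 hj).2], Finset.sum_const,
    nsmul_eq_mul]

theorem measurable_arms {K t : ℕ} : Measurable fun (h : History K t) (s : Fin t) => (h s).1 :=
  measurable_pi_lambda _ fun s => measurable_fst.comp (measurable_pi_apply s)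

theorem measurableSet_pulls {K t : ℕ} (m b : ℕ) (n : ℕ → Fin K → Fin (m + 1)) :
    MeasurableSet {h : History K t | ∀ a < b, pulls m a (fun s => (h s).1) = n a} :=
  measurable_arms (MeasurableSet.of_discrete (s := {f | ∀ a < b, pulls m a f = n a}))

theorem preimage_take_pulls {K B m b : ℕ} (hb : b * m ≤ B * m) (n : ℕ → Fin K → Fin (m + 1)) :
    {h : History K (B * m) | ∀ a < b, pulls m a (fun s => (h s).1) = n a} =
      History.take hb ⁻¹' {h | ∀ a < b, pulls m a (fun s => (h s).1) = n a} := by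
  ext h
  refine forall₂_congr fun a ha => ?_
  refine Eq.congr_left ?_
  funext i
  refine Fin.ext ?_
  rw [pulls_eq_card ha]
  rw [pulls, Fin.val_mk]
  refine congrArg Finset.card (Finset.ext fun j => ?_)
  have h1 := add_mul_lt_mul j ha
  rw [Finset.mem_filter, Finset.mem_filter]
  simp [h1.trans_le hb, History.take]

/-! ### The batch strategy of an algorithm -/

/-- The environment in which the reward of arm `i` in a round of the batch with index `b` has mean
parameter `θ b i`, the batches having length `m`. -/
def batchEnv (M : RewardModel) {K : ℕ} (m : ℕ) (θ : ℕ → Fin K → M.means) :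
    ℕ → Fin K → Measure ℝ :=
  fun s i => M.law (θ (s / m) i)

instance {M : RewardModel} {K m : ℕ} (θ : ℕ → Fin K → M.means) (s : ℕ) (i : Fin K) :
    IsProbabilityMeasure (batchEnv M m θ s i) :=
  inferInstanceAs (IsProbabilityMeasure (M.law _))

/-- From an algorithm with budget `B * m` one extracts batchwise numbers of pulls, chosen causally
as functions of the environment of the batches, and a recommendation, such that in every stationary
environment the recommendation is made with a probability bounded below by a divergence sum. -/
theorem exists_batch_strategy {M : RewardModel} {K B m : ℕ} (hK : 1 ≤ K)
    (π : Algorithm K (B * m)) :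
    ∃ (n : (ℕ → Fin K → M.means) → ℕ → Fin K → ℕ) (J : (ℕ → Fin K → M.means) → Fin K),
      (∀ b < B, ∀ θ θ', (∀ a ≤ b, θ a = θ' a) → n θ b = n θ' b) ∧
      (∀ θ, ∀ b < B, ∑ i, n θ b i = m) ∧
      ∀ θ (P : Fin K → M.means), (∀ b i, M.div (θ b i) (P i) ≠ ∞) → ∀ (l η : ℝ), 0 < l →
        (∀ b i, ∫⁻ x, (M.law (θ b i)).rnDeriv (M.law (P i)) x ^ l ∂(M.law (θ b i)) ≤
          ENNReal.ofReal (Real.exp (l * ((M.div (θ b i) (P i)).toReal + η)))) →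
        ENNReal.ofReal (Real.exp (-((1 + 1 / l) * Real.log (2 * (K * (((m : ℝ) + 1) ^ K) ^ B)) +
          ∑ b ∈ Finset.range B, ∑ i, n θ b i * ((M.div (θ b i) (P i)).toReal + η)))) ≤
          ∫⁻ h, π.recommend h {J θ} ∂(historyLaw π (fun i => M.law (P i)) (B * m)) := by
  have : Nonempty (Fin K) := ⟨⟨0, hK⟩⟩
  have hK0 : (0 : ℝ) < K := by exact_mod_cast hK
  obtain ⟨sel, hsel, hprob⟩ := exists_causal_selection
    (fun θ : ℕ → Fin K → M.means => varyingLaw π (batchEnv M m θ) (B * m))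
    (fun a h => pulls m a fun s => (h s).1) B (by
      intro b hb θ θ' hθ n
      have hbm := Nat.mul_le_mul_right m hb
      rw [preimage_take_pulls hbm]
      refine varyingLaw_preimage_take_congr π hbm (fun s hs => ?_) (measurableSet_pulls m b n)
      funext i
      rw [batchEnv, batchEnv, hθ _ (Nat.div_lt_of_lt_mul (by rwa [mul_comm]))])
  have hcard : (Fintype.card (Fin K → Fin (m + 1)) : ℝ≥0∞) ^ B =
      ENNReal.ofReal ((((m : ℝ) + 1) ^ K) ^ B) := by
    rw [← ENNReal.ofReal_natCast, ← ENNReal.ofReal_pow (by positivity)]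
    simp
  set A : (ℕ → Fin K → M.means) → Set (History K (B * m)) :=
    fun θ => {h | ∀ a < B, pulls m a (fun s => (h s).1) = sel θ a} with hA
  have hAm : ∀ θ, MeasurableSet (A θ) := fun θ => measurableSet_pulls m B (sel θ)
  -- Some arm is recommended with conditional probability at least `1 / K` given `A θ`.
  have hJ : ∀ θ, ∃ j, varyingLaw π (batchEnv M m θ) (B * m) (A θ) ≤
      K * ∫⁻ h in A θ, π.recommend h {j} ∂(varyingLaw π (batchEnv M m θ) (B * m)) := by
    intro θ
    obtain ⟨j, hj⟩ := Finite.exists_max fun j =>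
      ∫⁻ h in A θ, π.recommend h {j} ∂(varyingLaw π (batchEnv M m θ) (B * m))
    refine ⟨j, ?_⟩
    -- The sum over `j` of the recommendation probabilities is one.
    calc _ = ∫⁻ h in A θ, ∑ j, π.recommend h {j} ∂(varyingLaw π (batchEnv M m θ) (B * m)) := by
          simp
      _ = ∑ j, ∫⁻ h in A θ, π.recommend h {j} ∂(varyingLaw π (batchEnv M m θ) (B * m)) :=
          lintegral_finsetSum _ fun j _ => Kernel.measurable_coe _ (measurableSet_singleton j)
      _ ≤ ∑ _j : Fin K, _ := Finset.sum_le_sum fun j' _ => hj j'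
      _ = _ := by simp
  choose J hJ using hJ
  refine ⟨fun θ b i => sel θ b i, J, fun b hb θ θ' h => by simp only [hsel b hb θ θ' h],
    ?_, ?_⟩
  · intro θ b hb
    obtain ⟨h, hh⟩ : (A θ).Nonempty := by
      by_contra hne
      have h1 : 1 ≤ _ * varyingLaw π (batchEnv M m θ) (B * m) (A θ) := hprob θ
      simp [Set.not_nonempty_iff_eq_empty.1 hne] at h1
    simp only [← hh b hb, sum_pulls hb]
  · intro θ P hD l η hl hmom
    set w : History K (B * m) → ℝ≥0∞ := (A θ).indicator fun h => π.recommend h {J θ} with hw_def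
    have hw : Measurable w :=
      (Kernel.measurable_coe _ (measurableSet_singleton (J θ))).indicator (hAm θ)
    have hwle : ∀ h, w h ≤ π.recommend h {J θ} := fun h => Set.indicator_le_self _ _ h
    set q : ℝ := K * (((m : ℝ) + 1) ^ K) ^ B with hq_def
    have hq : 0 < q := by positivity
    have hpw : ENNReal.ofReal (1 / q) ≤ ∫⁻ h, w h ∂(varyingLaw π (batchEnv M m θ) (B * m)) := by
      rw [hw_def, lintegral_indicator (hAm θ), one_div, ENNReal.ofReal_inv_of_pos hq,
        ENNReal.inv_le_iff_le_mul (fun _ => by simp [hq]) (by simp)]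
      refine (hprob θ).trans ?_
      rw [hcard, hq_def, mul_comm (K : ℝ), ENNReal.ofReal_mul (by positivity),
        ENNReal.ofReal_natCast, mul_assoc]
      gcongr
      exact hJ θ
    refine le_trans ?_ (lintegral_mono hwle)
    rw [← varyingLaw_const]
    have key := le_lintegral_varyingLaw π (ν := batchEnv M m θ) (ρ := fun _ i => M.law (P i))
      (fun s i => M.law_absolutelyContinuous (hD _ i)) hl
      (E := fun s i => l * ((M.div (θ (s / m) i) (P i)).toReal + η)) (fun s i => hmom _ i) hw
      (fun h => (hwle h).trans prob_le_one)
      (C := l * ∑ b ∈ Finset.range B, ∑ i, (sel θ b i : ℕ) *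
        ((M.div (θ b i) (P i)).toReal + η)) (by
        intro h hh
        have hhA : h ∈ A θ := by
          by_contra hne
          exact hh (Set.indicator_of_notMem hne _)
        have h1 := sum_rounds_eq_sum_pulls (fun b i => (M.div (θ b i) (P i)).toReal + η)
          (fun s => (h s).1)
        rw [← Finset.mul_sum, h1]
        refine le_of_eq (congrArg _ (Finset.sum_congr rfl fun b hb => ?_))
        rw [hhA b (Finset.mem_range.1 hb)]) (one_div_pos.2 hq) hpw
    have e1 : (2 : ℝ) / (1 / q) = 2 * q := by field_simp
    rwa [e1, mul_div_cancel_left₀ _ hl.ne'] at key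

/-! ### The limiting oracle -/

theorem tendsto_log_card_div (K B : ℕ) (hK : 1 ≤ K) :
    Tendsto (fun m : ℕ => Real.log (2 * (K * (((m : ℝ) + 1) ^ K) ^ B)) / m) atTop (nhds 0) := by
  have hK0 : (0 : ℝ) < K := by exact_mod_cast hK
  have h1 : Tendsto (fun m : ℕ => Real.log ((m : ℝ) + 1) / m) atTop (nhds 0) := by
    have h := (Real.tendsto_pow_log_div_mul_add_atTop 1 (-1) 1 one_ne_zero).comp
      (tendsto_natCast_atTop_atTop.comp (tendsto_add_atTop_nat 1))
    simpa [Function.comp_def] using h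
  have h2 : Tendsto (fun m : ℕ => Real.log (2 * K) / m) atTop (nhds 0) :=
    tendsto_const_div_atTop_nhds_zero_nat _
  have h3 := h2.add (h1.const_mul ((B : ℝ) * K))
  rw [mul_zero, add_zero] at h3
  refine h3.congr fun m => ?_
  have hm : (0 : ℝ) < (m : ℝ) + 1 := by positivity
  rw [← mul_assoc (2 : ℝ), Real.log_mul (x := 2 * K) (by positivity) (by positivity),
    Real.log_pow, Real.log_pow]
  ring

/-- A lower bound `exp (-X)` on a probability bounds its exponent. -/
theorem toENNReal_log_inv_div_le {p : ℝ≥0∞} {X : ℝ} (h : ENNReal.ofReal (Real.exp (-X)) ≤ p)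
    {t : ℕ} (ht : 0 < t) :
    (ENNReal.log p⁻¹).toENNReal / (t : ℝ≥0∞) ≤ ENNReal.ofReal (X / t) := by
  rw [ENNReal.ofReal_div_of_pos (by exact_mod_cast ht), ENNReal.ofReal_natCast]
  gcongr
  have h1 : p⁻¹ ≤ ENNReal.ofReal (Real.exp X) := by
    rw [← neg_neg X, Real.exp_neg (-X), ENNReal.ofReal_inv_of_pos (Real.exp_pos _)]
    exact ENNReal.inv_le_inv.2 h
  have h2 : ENNReal.log p⁻¹ ≤ ((X : ℝ) : EReal) := by
    refine (ENNReal.log_monotone h1).trans (le_of_eq ?_)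
    rw [ENNReal.log_ofReal_of_pos (Real.exp_pos _), Real.log_exp]
  simpa using EReal.toENNReal_le_toENNReal h2

/-- Extension of a finite sequence by its last term. -/
def extend {X : Type*} {N : ℕ} (q : Fin (N + 1) → X) : ℕ → X :=
  fun a => q ⟨min a N, Nat.lt_succ_of_le (min_le_right a N)⟩

theorem extend_coe {X : Type*} {N : ℕ} (q : Fin (N + 1) → X) (a : Fin (N + 1)) :
    extend q a = q a := by
  simp [extend, Nat.lt_succ_iff.1 a.2]

theorem batchDivergence_eq_ofReal {M : RewardModel} {Θ : Set M.means} {K B : ℕ} (hB : 0 < B)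
    (r : Allocation M K B) (Q : Fin B → Fin K → M.means) (P : Fin K → Θ)
    (hD : ∀ b i, M.div (Q b i) (P i) ≠ ∞) :
    batchDivergence r Q P = ENNReal.ofReal
      ((∑ b, ∑ i, (r b (upTo Q b)).1 i * (M.div (Q b i) (P i)).toReal) / B) := by
  have h0 : ∀ b i, 0 ≤ (r b (upTo Q b)).1 i * (M.div (Q b i) (P i)).toReal := fun b i =>
    mul_nonneg ((r b (upTo Q b)).2.1 i) ENNReal.toReal_nonneg
  rw [batchDivergence, ENNReal.ofReal_div_of_pos (by exact_mod_cast hB), ENNReal.ofReal_natCast,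
    ENNReal.ofReal_sum_of_nonneg fun b _ => Finset.sum_nonneg fun i _ => h0 b i]
  congr 1
  refine Finset.sum_congr rfl fun b _ => ?_
  rw [ENNReal.ofReal_sum_of_nonneg fun i _ => h0 b i]
  refine Finset.sum_congr rfl fun i _ => ?_
  rw [ENNReal.ofReal_mul ((r b (upTo Q b)).2.1 i), ENNReal.ofReal_toReal (hD b i)]

/-- Limits, along an ultrafilter, of the batch strategies of the algorithms with budgets `B * m`
give an oracle that dominates the error exponent at all pairs of environments with finite
divergences. -/
theorem exists_oracle {M : RewardModel} {Θ : Set M.means} {K B : ℕ} (hK : 1 ≤ K) (hB : 1 ≤ B)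
    (π : (T : ℕ) → Algorithm K T) :
    ∃ (r : Allocation M K B) (J : (Fin B → Fin K → M.means) → Fin K),
      ∀ (Q : Fin B → Fin K → M.means) (P : Fin K → Θ), J Q ∉ bestArms P →
        (∀ b i, M.div (Q b i) (P i) ≠ ∞) → errorExponent π P ≤ batchDivergence r Q P := by
  obtain ⟨N, rfl⟩ : ∃ N, B = N + 1 := ⟨B - 1, by omega⟩
  choose n J hn hsum hbound using
    fun m : ℕ => exists_batch_strategy (M := M) (B := N + 1) (m := m) hK (π ((N + 1) * m))
  set U : Ultrafilter ℕ := Ultrafilter.of atTop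
  have hU : (U : Filter ℕ) ≤ atTop := Ultrafilter.of_le atTop
  have hpos : ∀ᶠ m : ℕ in (U : Filter ℕ), 0 < m := hU (eventually_gt_atTop 0)
  have hr : ∀ (b : Fin (N + 1)) (q : Fin (b + 1) → Fin K → M.means),
      ∃ x : stdSimplex ℝ (Fin K),
        Tendsto (fun (m : ℕ) (i : Fin K) => (n m (extend q) b i : ℝ) / m) U (nhds x.1) := by
    intro b q
    obtain ⟨x, hx, hlim⟩ := (isCompact_stdSimplex ℝ (Fin K)).ultrafilter_le_nhds
      (U.map fun (m : ℕ) (i : Fin K) => (n m (extend q) b i : ℝ) / m) (by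
        rw [le_principal_iff]
        refine hpos.mono fun m hm => ⟨fun i => by positivity, ?_⟩
        have hm' : (m : ℝ) ≠ 0 := by exact_mod_cast hm.ne'
        rw [← Finset.sum_div, div_eq_one_iff_eq hm']
        exact_mod_cast hsum m (extend q) b b.2)
    exact ⟨⟨x, hx⟩, hlim⟩
  choose r hr using hr
  have hJ : ∀ Q : Fin (N + 1) → Fin K → M.means, ∃ j, ∀ᶠ m in (U : Filter ℕ),
      J m (extend Q) = j := by
    intro Q
    obtain ⟨j, hj⟩ := Ultrafilter.eq_pure_of_finite (U.map fun m => J m (extend Q))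
    refine ⟨j, ?_⟩
    have : {j} ∈ U.map fun m => J m (extend Q) := by rw [hj]; exact Set.mem_singleton j
    exact this
  choose J' hJ' using hJ
  refine ⟨r, J', fun Q P hQP hD => ?_⟩
  have hrQ : ∀ b : Fin (N + 1), Tendsto
      (fun (m : ℕ) (i : Fin K) => (n m (extend Q) b i : ℝ) / m) U (nhds (r b (upTo Q b)).1) := by
    intro b
    refine (hr b (upTo Q b)).congr fun m => ?_
    rw [hn m b b.2 (extend (upTo Q b)) (extend Q)]
    intro a ha
    have hb := Nat.lt_succ_iff.1 b.2
    simp [extend, upTo, Fin.castLE, min_eq_left ha, min_eq_left (ha.trans hb)]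
  rw [batchDivergence_eq_ofReal N.succ_pos r Q P hD]
  refine ENNReal.le_of_forall_pos_le_add fun η hη _ => ?_
  have hη' : (0 : ℝ) < η := hη
  set D : Fin (N + 1) → Fin K → ℝ := fun b i => (M.div (Q b i) (P i)).toReal with hDdef
  obtain ⟨l, hmom, hl⟩ : ∃ l : ℝ, (∀ b i,
      ∫⁻ x, (M.law (Q b i)).rnDeriv (M.law (P i)) x ^ l ∂(M.law (Q b i)) ≤
        ENNReal.ofReal (Real.exp (l * (D b i + η)))) ∧ 0 < l :=
    ((eventually_all.2 fun b => eventually_all.2 fun i =>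
      M.eventually_lintegral_rnDeriv_law_rpow_le (hD b i) hη').and self_mem_nhdsWithin).exists
  set X : ℕ → ℝ := fun m => (1 + 1 / l) *
      Real.log (2 * (K * (((m : ℝ) + 1) ^ K) ^ (N + 1))) +
    ∑ b : Fin (N + 1), ∑ i, n m (extend Q) b i * (D b i + η) with hX
  -- The exponent at the budgets `(N + 1) * m`.
  have hle : ∀ᶠ m in (U : Filter ℕ),
      (ENNReal.log (errorProb (π ((N + 1) * m)) P)⁻¹).toENNReal / (((N + 1) * m : ℕ) : ℝ≥0∞) ≤
        ENNReal.ofReal (X m / ((N + 1) * m : ℕ)) := by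
    filter_upwards [hpos, hJ' Q] with m hm hmJ
    refine toENNReal_log_inv_div_le ?_ (Nat.mul_pos N.succ_pos hm)
    have key := hbound m (extend Q) (fun i => P i) (fun b i => hD _ i) l η hl
      (fun b i => hmom _ i)
    rw [← Fin.sum_univ_eq_sum_range (fun b => ∑ i, (n m (extend Q) b i : ℝ) *
      ((M.div (extend Q b i) (P i)).toReal + η))] at key
    simp_rw [extend_coe] at key
    refine key.trans (lintegral_mono fun h => measure_mono ?_)
    rw [hmJ]
    exact Set.singleton_subset_iff.2 hQP
  have hlim : Tendsto (fun m : ℕ => X m / ((N + 1) * m : ℕ)) U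
      (nhds ((∑ b, ∑ i, (r b (upTo Q b)).1 i * D b i) / ((N + 1 : ℕ) : ℝ) + η)) := by
    have h1 := (((tendsto_log_card_div K (N + 1) hK).mono_left hU).const_mul (1 + 1 / l)).add
      (tendsto_finsetSum Finset.univ fun b _ => tendsto_finsetSum Finset.univ fun i _ =>
        ((tendsto_pi_nhds.1 (hrQ b) i).mul_const (D b i + (η : ℝ))))
    have h2 := h1.div_const ((N + 1 : ℕ) : ℝ)
    have e : (∑ b, ∑ i, (r b (upTo Q b)).1 i * D b i) / ((N + 1 : ℕ) : ℝ) + η =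
        ((1 + 1 / l) * 0 + ∑ b, ∑ i, (r b (upTo Q b)).1 i * (D b i + η)) / ((N + 1 : ℕ) : ℝ) := by
      have h3 : ∀ b, ∑ i, (r b (upTo Q b)).1 i = 1 := fun b => (r b (upTo Q b)).2.2
      simp_rw [mul_add, Finset.sum_add_distrib, ← Finset.sum_mul, h3]
      simp only [Finset.sum_const, Finset.card_univ, Fintype.card_fin, nsmul_eq_mul]
      have : ((N + 1 : ℕ) : ℝ) ≠ 0 := by positivity
      field_simp
      ring
    rw [e]
    refine h2.congr' (hpos.mono fun m hm => ?_)
    have hm' : (m : ℝ) ≠ 0 := by exact_mod_cast hm.ne'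
    have h4 : ∑ b : Fin (N + 1), ∑ i, (n m (extend Q) b i : ℝ) / m * (D b i + η) =
        (∑ b : Fin (N + 1), ∑ i, (n m (extend Q) b i : ℝ) * (D b i + η)) / m := by
      simp_rw [Finset.sum_div, div_mul_eq_mul_div]
    rw [h4, hX]
    push_cast
    field_simp
  have htend : Tendsto (fun m : ℕ => (N + 1) * m) U atTop :=
    (tendsto_id.const_mul_atTop' N.succ_pos).mono_left hU
  calc errorExponent π P
      ≤ liminf (fun T : ℕ => (ENNReal.log (errorProb (π T) P)⁻¹).toENNReal / (T : ℝ≥0∞))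
          (map (fun m : ℕ => (N + 1) * m) U) := liminf_le_liminf_of_le htend
    _ = liminf (fun m : ℕ => (ENNReal.log (errorProb (π ((N + 1) * m)) P)⁻¹).toENNReal /
          (((N + 1) * m : ℕ) : ℝ≥0∞)) U := rfl
    _ ≤ liminf (fun m : ℕ => ENNReal.ofReal (X m / ((N + 1) * m : ℕ))) U := liminf_le_liminf hle
    _ = ENNReal.ofReal ((∑ b, ∑ i, (r b (upTo Q b)).1 i * D b i) / ((N + 1 : ℕ) : ℝ) + η) :=
        (ENNReal.tendsto_ofReal hlim).liminf_eq
    _ ≤ _ := ENNReal.ofReal_add_le.trans (by rw [ENNReal.ofReal_coe_nnreal])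

/-! ### Mixing with the uniform allocation -/

theorem scale_mono_right (c h : ℝ≥0∞) {x y : ℝ≥0∞} (hxy : x ≤ y) : scale c h x ≤ scale c h y := by
  unfold scale
  split_ifs with h1 h2 h2
  · exact le_rfl
  · have hy : y ≠ 0 := fun hy => h2 ⟨h1.1, hy⟩
    simp [h1.1, ENNReal.top_mul hy]
  · exact absurd ⟨h2.1, le_antisymm (hxy.trans h2.2.le) bot_le⟩ h1
  · gcongr

theorem mul_scale_le {c h x δ : ℝ≥0∞} (hδ0 : δ ≠ 0) (hδ1 : δ ≤ 1) :
    δ * scale c h x ≤ scale c h (δ * x) := by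
  unfold scale
  by_cases hx : h = ∞ ∧ x = 0
  · simpa [hx] using mul_le_of_le_one_left' hδ1
  · rw [if_neg hx, if_neg (by simpa [hδ0] using hx), mul_left_comm]

/-- The mixture of an allocation with the uniform one. -/
def mixUniform {M : RewardModel} {K B : ℕ} (hK : 1 ≤ K) (δ : unitInterval)
    (r : Allocation M K B) : Allocation M K B :=
  fun b q => ⟨fun i => δ * (r b q).1 i + (1 - δ) / K, fun i => by
      have h1 := (r b q).2.1 i
      have h2 := δ.2.1
      have h3 : 0 ≤ 1 - (δ : ℝ) := sub_nonneg.2 δ.2.2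
      positivity, by
      have hK0 : (K : ℝ) ≠ 0 := by positivity
      have h1 : ∑ i, (r b q).1 i = 1 := (r b q).2.2
      rw [Finset.sum_add_distrib, ← Finset.mul_sum, h1]
      simp only [Finset.sum_const, Finset.card_univ, Fintype.card_fin, nsmul_eq_mul]
      field_simp
      ring⟩

theorem mul_batchDivergence_le_mixUniform {M : RewardModel} {Θ : Set M.means} {K B : ℕ}
    (hK : 1 ≤ K) (δ : unitInterval) (r : Allocation M K B) (Q : Fin B → Fin K → M.means)
    (P : Fin K → Θ) :
    ENNReal.ofReal δ * batchDivergence r Q P ≤ batchDivergence (mixUniform hK δ r) Q P := by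
  have h3 : 0 ≤ 1 - (δ : ℝ) := sub_nonneg.2 δ.2.2
  rw [batchDivergence, batchDivergence, ← mul_div_assoc, Finset.mul_sum]
  simp_rw [Finset.mul_sum, ← mul_assoc, ← ENNReal.ofReal_mul δ.2.1]
  refine ENNReal.div_le_div_right (Finset.sum_le_sum fun b _ => Finset.sum_le_sum fun i _ => ?_) _
  gcongr
  exact le_add_of_nonneg_right (by positivity)

theorem batchDivergence_mixUniform_eq_top {M : RewardModel} {Θ : Set M.means} {K B : ℕ}
    (hK : 1 ≤ K) {δ : unitInterval} (hδ : δ < 1) (r : Allocation M K B)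
    {Q : Fin B → Fin K → M.means} {P : Fin K → Θ} {b : Fin B} {i : Fin K}
    (h : M.div (Q b i) (P i) = ∞) : batchDivergence (mixUniform hK δ r) Q P = ∞ := by
  rw [batchDivergence]
  refine ENNReal.div_eq_top.2 (Or.inr ⟨?_, ENNReal.natCast_ne_top B⟩)
  refine ENNReal.sum_eq_top.2 ⟨b, Finset.mem_univ b, ENNReal.sum_eq_top.2 ⟨i, Finset.mem_univ i, ?_⟩⟩
  rw [h, ENNReal.mul_top]
  have h1 := (r b (upTo Q b)).2.1 i
  have h2 := δ.2.1
  have h3 : 0 < 1 - (δ : ℝ) := sub_pos.2 hδ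
  have h4 : (0 : ℝ) < K := by exact_mod_cast hK
  have h5 : 0 < δ * (r b (upTo Q b)).1 i + (1 - δ) / K := by positivity
  exact (ENNReal.ofReal_pos.2 h5).ne'

end FixedBudget

end

theorem mainTheorem3 (M : FixedBudget.RewardModel) (Θ : Set M.means) (K : ℕ) (hK : 1 ≤ K)
    (H : (Fin K → Θ) → ENNReal) (hH : ∀ P, 0 < H P) (c : ENNReal)
    (π : (T : ℕ) → FixedBudget.Algorithm K T) (B : ℕ) (hB : 1 ≤ B) :
    FixedBudget.rate c H π ≤ FixedBudget.oracleRate c H B := by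
  obtain ⟨r, J, hrJ⟩ := FixedBudget.exists_oracle (M := M) (Θ := Θ) hK hB π
  refine ENNReal.le_of_forall_lt_one_mul_le fun a ha => ?_
  rcases eq_or_ne a 0 with rfl | ha0
  · simp
  -- The weight `a` of the limiting oracle, as an element of the unit interval.
  have ha' : a.toReal < 1 := by
    simpa using (ENNReal.toReal_lt_toReal ha.ne_top ENNReal.one_ne_top).2 ha
  let δ : unitInterval := ⟨a.toReal, ENNReal.toReal_nonneg, ha'.le⟩
  have hδ : ENNReal.ofReal δ = a := ENNReal.ofReal_toReal ha.ne_top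
  refine le_trans ?_ (le_iSup₂ (f := fun (r : FixedBudget.Allocation M K B)
    (J : (Fin B → Fin K → M.means) → Fin K) => ⨅ (Q : Fin B → Fin K → M.means) (P : Fin K → Θ)
      (_ : J Q ∉ FixedBudget.bestArms P),
        FixedBudget.scale c (H P) (FixedBudget.batchDivergence r Q P))
    (FixedBudget.mixUniform hK δ r) J)
  refine le_iInf fun Q => le_iInf fun P => le_iInf fun hQP => ?_
  by_cases hD : ∀ b i, M.div (Q b i) (P i) ≠ ⊤
  · calc a * FixedBudget.rate c H π
        ≤ a * FixedBudget.scale c (H P) (FixedBudget.errorExponent π P) := by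
          gcongr
          exact iInf_le _ P
      _ ≤ FixedBudget.scale c (H P) (a * FixedBudget.errorExponent π P) :=
          FixedBudget.mul_scale_le ha0 ha.le
      _ ≤ _ := by
          refine FixedBudget.scale_mono_right c (H P) (le_trans ?_
            (FixedBudget.mul_batchDivergence_le_mixUniform hK δ r Q P))
          rw [hδ]
          gcongr
          exact hrJ Q P hQP hD
  · push Not at hD
    obtain ⟨b, i, hbi⟩ := hD
    have hδ1 : δ < 1 := ha'
    rw [FixedBudget.batchDivergence_mixUniform_eq_top hK hδ1 r hbi]
    simp [FixedBudget.scale, ENNReal.mul_top (hH P).ne']
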